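/- Let $\Bbbk$ be a field and let $Q$ be a finite quiver with $n$ vertices (its path algebra $\Bbbk Q$ is hereditary). Let $\mathrm{rep}_{\Bbbk}(Q)$ be the abelian category of finite dimensional representations of $Q$ over $\Bbbk$; $\mathrm{Hom}$ and $\mathrm{Ext}^i$ are taken in this category and $\mathrm{Ext}=\mathrm{Ext}^1$. A representation $V$ is exceptional if $\mathrm{End}(V)$ is a division ring and $\mathrm{Ext}^i(V,V)=0$ for all $i\ge 1$. A complete exceptional sequence is a sequence $(E_1,\dots,E_n)$ of exceptional representations, of length equal to the number of vertices of $Q$, such that $\mathrm{Hom}(E_i,E_j)=0=\mathrm{Ext}(E_i,E_j)$ for all $j<i$. A complete exceptional set is a set of representations that can be ordered so as to form a complete exceptional sequence. For a representation $V$, the right perpendicular category $V^{\perp}$ is the full subcategory of $\mathrm{rep}_{\Bbbk}(Q)$ of those $W$ with $\mathrm{Hom}(V,W)=0=\mathrm{Ext}(V,W)$. The term $E_i$ of a complete exceptional sequence $(E_1,\dots,E_n)$ is relatively projective in the sequence if $E_i$ is a projective object of the category $(E_{i+1}\oplus\cdots\oplus E_n)^{\perp}$. Theorem. (1) Let $(E_1,\dots,E_n)$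 and $(E'_1,\dots,E'_n)$ be complete exceptional sequences and let $\sigma$ be a permutation of $\{1,\dots,n\}$ with $E'_i\cong E_{\sigma(i)}$ for all $i$. Then, for every $i$, $E'_i$ is relatively projective in $(E'_1,\dots,E'_n)$ if and only if $E_{\sigma(i)}$ is relatively projective in $(E_1,\dots,E_n)$. (2) Consequently, for every complete exceptional set $S$ there is a unique subset $R\subseteq S$ such that, for every ordering $(E_1,\dots,E_n)$ of $S$ that is a complete exceptional sequence and every $i$, the term $E_i$ is relatively projective in $(E_1,\dots,E_n)$ if and only if $E_i\in R$. -/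

import Mathlib

open CategoryTheory CategoryTheory.Limits

universe u v w

/-- The category `rep_k(Q)` of finite dimensional representations of a quiver `Q` over a field
`k`: a functor out of the free category on `Q` is a choice of a finite dimensional `k`-vector
space for every vertex and of a `k`-linear map for every arrow; a natural transformation is a
family of linear maps commuting with the arrow maps. -/
abbrev QuiverRep (k : Type u) [Field k] (Q : Type v) [Quiver.{w} Q] :=
  Paths Q ⥤ FGModuleCat.{u} k

namespace QuiverRep

variable {k : Type u} [Field k] {Q : Type v} [Quiver.{w} Q]

/-- `Ext`-groups in the abelian category of finite dimensional representations. -/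
instance instHasExt : HasExt.{max (u + 1) v w} (QuiverRep k Q) :=
  HasExt.standard (QuiverRep k Q)

/-- Finite direct sums of representations exist. -/
instance instHasFiniteBiproducts : HasFiniteBiproducts (QuiverRep k Q) :=
  Abelian.hasFiniteBiproducts

/-- `V` is exceptional: `End(V)` is a division ring and `Ext^i(V, V) = 0` for all `i ≥ 1`. -/
structure IsExceptional (V : QuiverRep k Q) : Prop where
  end_nontrivial : Nontrivial (End V)
  end_isUnit : ∀ f : End V, f ≠ 0 → IsUnit f
  ext_self : ∀ i : ℕ, 1 ≤ i → Subsingleton (Abelian.Ext V V i)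

/-- The right perpendicular category `V^⊥`, as a property of representations `W`:
`Hom(V, W) = 0 = Ext(V, W)`. -/
def rightPerp (V : QuiverRep k Q) : ObjectProperty (QuiverRep k Q) := fun W =>
  Subsingleton (V ⟶ W) ∧ Subsingleton (Abelian.Ext V W 1)

/-- `M` is relatively projective with respect to `V`: it is an object of the full subcategory
`V^⊥` and a projective object of that category. -/
def IsRelProjectiveWrt (M V : QuiverRep k Q) : Prop :=
  ∃ hM : rightPerp V M, Projective (⟨M, hM⟩ : (rightPerp V).FullSubcategory)

/-- `(E_0, …, E_{m-1})` is an exceptional sequence: all terms are exceptional and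
`Hom(E_i, E_j) = 0 = Ext(E_i, E_j)` for `j < i`. -/
structure IsExceptionalSeq {m : ℕ} (E : Fin m → QuiverRep k Q) : Prop where
  exceptional : ∀ i, IsExceptional (E i)
  hom_eq_zero : ∀ i j, j < i → Subsingleton (E i ⟶ E j)
  ext_eq_zero : ∀ i j, j < i → Subsingleton (Abelian.Ext (E i) (E j) 1)

/-- A complete exceptional sequence: the number of terms is the number of vertices of `Q`. -/
def IsCompleteExceptionalSeq {m : ℕ} (E : Fin m → QuiverRep k Q) : Prop :=
  IsExceptionalSeq E ∧ m = Nat.card Q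

/-- A complete exceptional set: a set of representations which can be ordered so as to form a
complete exceptional sequence. (The terms of an exceptional sequence are pairwise distinct.) -/
def IsCompleteExceptionalSet (S : Set (QuiverRep k Q)) : Prop :=
  ∃ E : Fin (Nat.card Q) → QuiverRep k Q, IsCompleteExceptionalSeq E ∧ Set.range E = S

/-- The term `E_i` is relatively projective in the sequence `E`: it is relatively projective with
respect to the direct sum of the later terms (the zero representation for the last term). -/
noncomputable def IsRelProjectiveIn {m : ℕ} (E : Fin m → QuiverRep k Q) (i : Fin m) : Prop :=
  IsRelProjectiveWrt (E i) (⨁ fun j : {j : Fin m // i < j} => E j)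

end QuiverRep

/-! Relative projectivity of `E i` means that `Ext¹(E i, -)` vanishes on every object right
perpendicular to all later terms (`isRelProjectiveIn_iff`). To pass to another ordering,
perpendicularity to a term `B` that comes after `A = E i` in the first ordering but before it in the
second must be dropped. Such terms are dropped one at a time, the earliest in the first ordering
first (`subsingleton_ext_of_reorder`).

Dropping `B` works because the second ordering puts `B` in `A^⊥`
(`subsingleton_ext_of_forall_rightPerp`). Embed `X` in an extension `Y` by copies of `B` with
`Ext¹(B, Y) = 0`, and divide `Y` by the image of all maps from `B`; the quotient lies in `B^⊥`.
Vanishing of `Ext¹(A, -)` passes from this quotient to `Y`, as the image is a quotient of copies of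
`B`, and then to `X`, as `Hom(A, B) = 0`.

Heredity enters as right exactness of `Ext¹(V, -)`, proved by describing classes through
off-diagonal arrow maps, which lift freely along epimorphisms (`ext_one_comp_surjective`). -/

open DerivedCategory Pretriangulated in
/-- Every `Ext¹`-class is killed by some monomorphism out of its second argument. -/
lemma CategoryTheory.Abelian.Ext.exists_mono_comp_eq_zero
    {C : Type u} [Category.{v} C] [Abelian C] [HasExt.{w} C]
    {X Y : C} (e : Ext X Y 1) :
    ∃ (Z : C) (f : Y ⟶ Z), Mono f ∧ e.comp (mk₀ f) (add_zero 1) = 0 := by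
  let := HasDerivedCategory.standard C
  let e' : (singleFunctor C 0).obj X ⟶ ((singleFunctor C 0).obj Y)⟦(1 : ℤ)⟧ := e.hom
  obtain ⟨Z', f', g', hT⟩ := distinguished_cocone_triangle₂ e'
  -- The heart is closed under extensions, so the middle term of the triangle is an object of `C`.
  have hGE : Z'.IsGE 0 := TStructure.t.isGE₂ _ hT 0
    (inferInstanceAs (TStructure.t.IsGE ((singleFunctor C 0).obj Y) 0))
    (inferInstanceAs (TStructure.t.IsGE ((singleFunctor C 0).obj X) 0))
  have hLE : Z'.IsLE 0 := TStructure.t.isLE₂ _ hT 0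
    (inferInstanceAs (TStructure.t.IsLE ((singleFunctor C 0).obj Y) 0))
    (inferInstanceAs (TStructure.t.IsLE ((singleFunctor C 0).obj X) 0))
  obtain ⟨Z, ⟨i⟩⟩ := exists_iso_singleFunctor_obj_of_isGE_of_isLE Z' 0
  obtain ⟨f, hf⟩ := (singleFunctor C 0).map_surjective (f' ≫ i.hom)
  have he' : e' ≫ (shiftFunctor _ (1 : ℤ)).map f' = 0 := comp_distTriang_mor_zero₃₁ _ hT
  refine ⟨Z, f, Preadditive.mono_of_cancel_zero _ fun {T} h hh => ?_, ?_⟩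
  · have h0 : (singleFunctor C 0).map h ≫ f' = 0 := by
      rw [← cancel_mono i.hom, Category.assoc, ← hf, ← Functor.map_comp, hh]
      simp
    have h1 : (shiftFunctor _ (1 : ℤ)).map ((singleFunctor C 0).map h) ≫
        (shiftFunctor _ (1 : ℤ)).map f' = 0 := by
      rw [← Functor.map_comp, h0, Functor.map_zero]
    obtain ⟨c, hc⟩ : ∃ c : ((singleFunctor C 0).obj T)⟦(1 : ℤ)⟧ ⟶ (singleFunctor C 0).obj X,
        (shiftFunctor _ (1 : ℤ)).map ((singleFunctor C 0).map h) = c ≫ e' :=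
      Triangle.coyoneda_exact₁ _ hT _ h1
    -- `T[1]` sits in degree `-1` and `X` in degree `0`, so `c` vanishes.
    have hL : TStructure.t.IsLE (((singleFunctor C 0).obj T)⟦(1 : ℤ)⟧) (-1) :=
      TStructure.t.isLE_shift _ 0 1 (-1)
    have hc0 : c = 0 := TStructure.t.zero_of_isLE_of_isGE c (-1) 0 (by lia) hL
      (inferInstanceAs (TStructure.t.IsGE ((singleFunctor C 0).obj X) 0))
    rw [hc0, Limits.zero_comp] at hc
    apply (singleFunctor C 0).map_injective
    apply (shiftFunctor _ (1 : ℤ)).map_injective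
    rw [hc]
    simp
  · ext
    rw [comp_hom, mk₀_hom, ShiftedHom.comp_mk₀, hf, Functor.map_comp, zero_hom]
    change e' ≫ (shiftFunctor _ (1 : ℤ)).map f' ≫ (shiftFunctor _ (1 : ℤ)).map i.hom = 0
    rw [reassoc_of% he', Limits.zero_comp]

universe u' v'

namespace CategoryTheory

lemma ShortComplex.exact_of_evaluation {J C : Type*} [Category* J] [Category* C] [Abelian C]
    (S : ShortComplex (J ⥤ C)) (h : ∀ j, (S.map ((evaluation J C).obj j)).Exact) : S.Exact := by
  rw [S.exact_iff_isZero_homology]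
  refine Functor.isZero _ fun j => ?_
  exact ((S.map ((evaluation J C).obj j)).exact_iff_isZero_homology.1 (h j)).of_iso
    (S.mapHomologyIso ((evaluation J C).obj j)).symm

/-! ### Block triangular morphisms -/

section Triangular

variable {C : Type u'} [Category.{v'} C] [Abelian C] {X X' Y Y' V V' W W' Z Z' : C}

/-- The triangular morphism `X ⊞ V ⟶ X' ⊞ V'` with diagonal entries `x`, `v` and
off-diagonal entry `ψ`. -/
noncomputable abbrev triangular (x : X ⟶ X') (v : V ⟶ V') (ψ : V ⟶ X') : X ⊞ V ⟶ X' ⊞ V' :=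
  biprod.desc (x ≫ biprod.inl) (ψ ≫ biprod.inl + v ≫ biprod.inr)

lemma triangular_snd (x : X ⟶ X') (v : V ⟶ V') (ψ : V ⟶ X') :
    triangular x v ψ ≫ biprod.snd = biprod.snd ≫ v := by
  apply biprod.hom_ext' <;> simp

lemma triangular_map {x : X ⟶ X'} {v : V ⟶ V'} {ψ : V ⟶ X'} {y : Y ⟶ Y'} {w : W ⟶ W'}
    {φ : W ⟶ Y'} {p : X ⟶ Y} {p' : X' ⟶ Y'} {q : V ⟶ W} {q' : V' ⟶ W'}
    (hp : x ≫ p' = p ≫ y) (hq : v ≫ q' = q ≫ w) (h : ψ ≫ p' = q ≫ φ) :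
    triangular x v ψ ≫ biprod.map p' q' = biprod.map p q ≫ triangular y w φ := by
  apply biprod.hom_ext' <;> simp [reassoc_of% hp, reassoc_of% hq, reassoc_of% h]

lemma triangular_desc {x : X ⟶ X'} {v : V ⟶ V'} {ψ : V ⟶ X'} {f : X ⟶ Z} {f' : X' ⟶ Z'}
    {s : V ⟶ Z} {s' : V' ⟶ Z'} {e : Z ⟶ Z'} (hf : x ≫ f' = f ≫ e)
    (hs : ψ ≫ f' = s ≫ e - v ≫ s') :
    triangular x v ψ ≫ biprod.desc f' s' = biprod.desc f s ≫ e := by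
  apply biprod.hom_ext' <;> simp [hf, hs]

/-- The failure of the sections to commute with `e` and `v` is killed by `g'`, hence factors through
the kernel `X'`. -/
lemma exists_triangular_entry {g : Z ⟶ V} {f' : X' ⟶ Z'} {g' : Z' ⟶ V'}
    {w' : f' ≫ g' = 0} (hS : (ShortComplex.mk f' g' w').ShortExact) {v : V ⟶ V'} {e : Z ⟶ Z'}
    (hg : g ≫ v = e ≫ g') {s : V ⟶ Z} {s' : V' ⟶ Z'} (hs : s ≫ g = 𝟙 _) (hs' : s' ≫ g' = 𝟙 _) :
    ∃ ψ : V ⟶ X', ψ ≫ f' = s ≫ e - v ≫ s' := by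
  have := hS.mono_f
  exact ⟨hS.exact.lift (s ≫ e - v ≫ s') (by simp [← hg, reassoc_of% hs, hs']),
    hS.exact.lift_f _ _⟩

end Triangular

/-! ### Extensions of quiver representations by cocycles -/

namespace Paths

variable {Q : Type u} [Quiver.{v} Q] {C : Type u'} [Category.{v'} C] [Abelian C]

/-- The off-diagonal arrow maps of an extension of `V` by `X`. -/
abbrev Cocycle (V X : Paths Q ⥤ C) : Type _ :=
  ∀ a b : Q, (a ⟶ b) → (V.obj ((of Q).obj a) ⟶ X.obj ((of Q).obj b))

/-- The functor `X ⊕ V` with the off-diagonal arrow maps given by `ψ`. -/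
noncomputable def extObj (V X : Paths Q ⥤ C) (ψ : Cocycle V X) : Paths Q ⥤ C :=
  lift
    { obj a := X.obj ((of Q).obj a) ⊞ V.obj ((of Q).obj a)
      map {a b} α := triangular (X.map ((of Q).map α)) (V.map ((of Q).map α)) (ψ a b α) }

variable {V X V' X' : Paths Q ⥤ C} (ψ : Cocycle V X) (ψ' : Cocycle V' X')

lemma extObj_map_toPath {a b : Q} (α : a ⟶ b) :
    (extObj V X ψ).map α.toPath =
      triangular (X.map ((of Q).map α)) (V.map ((of Q).map α)) (ψ a b α) :=
  lift_toPath _ _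

/-- The inclusion of `X` in `extObj V X ψ`. -/
noncomputable def extInl : X ⟶ extObj V X ψ :=
  liftNatTrans (fun a => (biprod.inl : X.obj ((of Q).obj a) ⟶ _ ⊞ V.obj ((of Q).obj a)))
    fun α => by
      rw [extObj_map_toPath]
      exact (biprod.inl_desc _ _).symm

/-- The projection of `extObj V X ψ` to `V`. -/
noncomputable def extSnd : extObj V X ψ ⟶ V :=
  liftNatTrans (fun a => (biprod.snd : X.obj ((of Q).obj a) ⊞ V.obj ((of Q).obj a) ⟶ _))
    fun α => by
      rw [extObj_map_toPath]
      exact triangular_snd _ _ _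

/-- The extension of `V` by `X` with off-diagonal arrow maps `ψ`. -/
noncomputable abbrev extShortComplex : ShortComplex (Paths Q ⥤ C) where
  X₁ := X
  X₂ := extObj V X ψ
  X₃ := V
  f := extInl ψ
  g := extSnd ψ
  zero := by
    ext a
    exact biprod.inl_snd

lemma extShortComplex_shortExact : (extShortComplex ψ).ShortExact := by
  have h (a : Paths Q) : ((extShortComplex ψ).map ((evaluation _ C).obj a)).ShortExact :=
    (ShortComplex.Splitting.ofHasBinaryBiproduct (X.obj a) (V.obj a)).shortExact
  have : Mono (extShortComplex ψ).f := NatTrans.mono_iff_mono_app _ |>.2 fun a => (h a).mono_f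
  have : Epi (extShortComplex ψ).g := NatTrans.epi_iff_epi_app _ |>.2 fun a => (h a).epi_g
  exact ⟨ShortComplex.exact_of_evaluation _ fun a => (h a).exact⟩

/-- A morphism of extensions which is diagonal in the coordinates. -/
noncomputable def extShortComplexMap (p : X ⟶ X') (q : V ⟶ V')
    (h : ∀ a b (α : a ⟶ b), ψ a b α ≫ p.app _ = q.app _ ≫ ψ' a b α) :
    extShortComplex ψ ⟶ extShortComplex ψ' where
  τ₁ := p
  τ₂ := liftNatTrans
    (fun a => biprod.map (p.app ((of Q).obj a)) (q.app ((of Q).obj a))) fun {a b} α => by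
      rw [extObj_map_toPath, extObj_map_toPath]
      exact triangular_map (p.naturality _) (q.naturality _) (h a b α)
  τ₃ := q
  comm₁₂ := by
    ext a
    exact (biprod.inl_map _ _).symm
  comm₂₃ := by
    ext a
    exact biprod.map_snd _ _

/-- Every short exact sequence of representations in a category in which all objects are
projective is isomorphic to one in standard form. -/
lemma exists_extShortComplex_hom (hC : ∀ Y : C, Projective Y) {E : Paths Q ⥤ C} {f : X ⟶ E}
    {g : E ⟶ V} {w : f ≫ g = 0} (hS : (ShortComplex.mk f g w).ShortExact) :
    ∃ (ψ : Cocycle V X) (h : extShortComplex ψ ⟶ ShortComplex.mk f g w),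
      h.τ₁ = 𝟙 X ∧ h.τ₃ = 𝟙 V := by
  have w' (a) : f.app a ≫ g.app a = 0 := by rw [← NatTrans.comp_app, w]; rfl
  have hS' (a) : (ShortComplex.mk (f.app a) (g.app a) (w' a)).ShortExact :=
    hS.map_of_exact ((evaluation _ C).obj a)
  -- The sequence splits at each vertex; the incompatibility of these splittings with the arrows is
  -- `ψ`.
  have hs (a) : ∃ s : V.obj a ⟶ E.obj a, s ≫ g.app a = 𝟙 _ :=
    have : Epi (g.app a) := (hS' a).epi_g
    ⟨Projective.factorThru (𝟙 _) (g.app a), Projective.factorThru_comp _ _⟩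
  choose s hs using hs
  have hψ (a b : Q) (α : a ⟶ b) := exists_triangular_entry (hS' ((of Q).obj b))
    (g.naturality ((of Q).map α)).symm (hs _) (hs _)
  choose ψ hψ using hψ
  refine ⟨ψ, ⟨𝟙 X, liftNatTrans (fun a => biprod.desc (f.app ((of Q).obj a)) (s ((of Q).obj a))) ?_,
    𝟙 V, ?_, ?_⟩, rfl, rfl⟩
  · intro a b α
    rw [extObj_map_toPath]
    exact triangular_desc (f.naturality _) (hψ a b α)
  · ext a
    exact (Category.id_comp _).trans (biprod.inl_desc _ _).symm
  · ext a
    change biprod.desc (f.app a) (s a) ≫ g.app a = biprod.snd ≫ 𝟙 _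
    apply biprod.hom_ext' <;> simp [w', hs]

open Abelian

section Ext

variable [HasExt.{w} (Paths Q ⥤ C)]

/-- The `Ext¹`-class with off-diagonal arrow maps `ψ`. -/
noncomputable def cocycleClass : Ext V X 1 := (extShortComplex_shortExact ψ).extClass

lemma cocycleClass_comp_eq (p : X ⟶ X') (q : V ⟶ V')
    (h : ∀ a b (α : a ⟶ b), ψ a b α ≫ p.app _ = q.app _ ≫ ψ' a b α) :
    (cocycleClass ψ).comp (Ext.mk₀ p) (add_zero 1) =
      (Ext.mk₀ q).comp (cocycleClass ψ') (zero_add 1) :=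
  ShortComplex.ShortExact.extClass_naturality _ _ (extShortComplexMap ψ ψ' p q h)

lemma mk₀_comp_cocycleClass (q : V' ⟶ V) :
    (Ext.mk₀ q).comp (cocycleClass ψ) (zero_add 1) =
      cocycleClass fun a b α => q.app ((of Q).obj a) ≫ ψ a b α := by
  rw [← cocycleClass_comp_eq (fun a b α => q.app ((of Q).obj a) ≫ ψ a b α) ψ (𝟙 X) q
    fun _ _ _ => Category.comp_id _, Ext.comp_mk₀_id]

lemma cocycleClass_comp_mk₀ (p : X ⟶ X') :
    (cocycleClass ψ).comp (Ext.mk₀ p) (add_zero 1) =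
      cocycleClass fun a b α => ψ a b α ≫ p.app ((of Q).obj b) := by
  rw [cocycleClass_comp_eq ψ (fun a b α => ψ a b α ≫ p.app ((of Q).obj b)) p (𝟙 V)
    fun _ _ _ => (Category.id_comp _).symm, Ext.mk₀_id_comp]

/-- A monomorphism `f` killing `e` exhibits `e` as the pullback, along some `q : V ⟶ cokernel f`, of
the class of an honest short exact sequence. That sequence has a standard form, and pullbacks of
cocycle classes are cocycle classes. -/
lemma exists_eq_cocycleClass (hC : ∀ Y : C, Projective Y) (e : Ext V X 1) :
    ∃ ψ : Cocycle V X, e = cocycleClass ψ := by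
  obtain ⟨Z, f, _, hf⟩ := e.exists_mono_comp_eq_zero
  have hS : (ShortComplex.mk f (cokernel.π f) (cokernel.condition f)).ShortExact :=
    { exact := ShortComplex.exact_cokernel f }
  obtain ⟨x, rfl⟩ := Ext.covariant_sequence_exact₁ V hS e hf (zero_add 1)
  obtain ⟨q, rfl⟩ := (Ext.mk₀_bijective _ _).2 x
  obtain ⟨ψ, h, h₁, h₃⟩ := exists_extShortComplex_hom hC hS
  have h1 := ShortComplex.ShortExact.extClass_naturality (extShortComplex_shortExact ψ) hS h
  rw [h₁, h₃, Ext.mk₀_id_comp, Ext.comp_mk₀_id] at h1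
  exact ⟨_, by rw [← h1]; exact mk₀_comp_cocycleClass ψ q⟩

/-- Right exactness of `Ext¹(V, -)`. -/
lemma ext_one_comp_surjective (hC : ∀ Y : C, Projective Y) (p : X ⟶ X') [Epi p]
    (e : Ext V X' 1) : ∃ e' : Ext V X 1, e'.comp (Ext.mk₀ p) (add_zero 1) = e := by
  obtain ⟨ψ, rfl⟩ := exists_eq_cocycleClass hC e
  have (a : Paths Q) : Epi (p.app a) := NatTrans.epi_iff_epi_app _ |>.1 inferInstance a
  refine ⟨cocycleClass fun a b α => Projective.factorThru (ψ a b α) (p.app _), ?_⟩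
  rw [cocycleClass_comp_mk₀]
  simp

end Ext

end Paths

end CategoryTheory

lemma FGModuleCat.projective {k : Type u} [Field k] (M : FGModuleCat.{u} k) : Projective M where
  factors {E X} f e he := by
    have he' : Epi e.hom := inferInstanceAs (Epi ((forget₂ (FGModuleCat k) (ModuleCat k)).map e))
    obtain ⟨h, hh⟩ := Module.projective_lifting_property e.hom.hom f.hom.hom
      ((ModuleCat.epi_iff_surjective _).1 he')
    exact ⟨⟨ModuleCat.ofHom h⟩, by ext x; exact LinearMap.congr_fun hh x⟩

/-! ### Perpendicular categories and their projectives -/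

namespace QuiverRep

open Abelian Paths

variable {k : Type u} [Field k] {Q : Type v} [Quiver.{w} Q]

/-- Right exactness of `Ext¹(V, -)`. -/
lemma subsingleton_ext_one_of_epi {V X Y : QuiverRep k Q} (p : X ⟶ Y) [Epi p]
    (h : Subsingleton (Ext V X 1)) : Subsingleton (Ext V Y 1) := by
  refine subsingleton_of_forall_eq 0 fun e => ?_
  obtain ⟨e', rfl⟩ := ext_one_comp_surjective FGModuleCat.projective p e
  rw [Subsingleton.elim e' 0, Ext.zero_comp]

lemma finite_hom [Finite Q] (V X : QuiverRep k Q) : Module.Finite k (V ⟶ X) := by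
  let φ : (V ⟶ X) →ₗ[k] (∀ a : Q, V.obj ((of Q).obj a) ⟶ X.obj ((of Q).obj a)) :=
    { toFun f a := f.app ((of Q).obj a)
      map_add' _ _ := rfl
      map_smul' _ _ := rfl }
  exact Module.Finite.of_injective φ fun f g h => NatTrans.ext h

/-- `Ext¹(B, X)` is generated by finitely many classes. -/
lemma exists_cocycle_generating [Finite Q] [∀ a b : Q, Finite (a ⟶ b)] (B X : QuiverRep k Q) :
    ∃ (n : ℕ) (ψ : Cocycle (⨁ fun _ : Fin n => B) X), ∀ e : Ext B X 1,
      ∃ q, e = (Ext.mk₀ q).comp (cocycleClass ψ) (zero_add 1) := by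
  -- Finitely many arrows make the cocycles a finite dimensional space; `ψ` assembles a spanning
  -- family.
  obtain ⟨n, s, hs⟩ := Module.Finite.exists_fin (R := k) (M := Cocycle B X)
  refine ⟨n, fun a b α => ∑ i, (biproduct.π (fun _ : Fin n => B) i).app _ ≫ s i a b α,
    fun e => ?_⟩
  obtain ⟨φ, rfl⟩ := exists_eq_cocycleClass FGModuleCat.projective e
  obtain ⟨c, rfl⟩ := (Submodule.mem_span_range_iff_exists_fun k).1
    (hs ▸ Submodule.mem_top : φ ∈ Submodule.span k (Set.range s))
  refine ⟨biproduct.lift fun i => c i • 𝟙 B, ?_⟩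
  rw [mk₀_comp_cocycleClass]
  congr 1
  ext1 a; ext1 b; ext1 α
  have (i : Fin n) : (biproduct.lift fun i => c i • 𝟙 B).app ((of Q).obj a) ≫
      (biproduct.π (fun _ : Fin n => B) i).app _ = c i • 𝟙 _ := by
    rw [← NatTrans.comp_app, biproduct.lift_π]
    rfl
  simp only [Preadditive.comp_sum, reassoc_of% this, Linear.smul_comp, Category.id_comp,
    Finset.sum_apply, Pi.smul_apply]

lemma subsingleton_ext_biproduct_left {ι : Type*} [Finite ι] {f : ι → QuiverRep k Q}
    {X : QuiverRep k Q} {n : ℕ} :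
    Subsingleton (Ext (⨁ f) X n) ↔ ∀ i, Subsingleton (Ext (f i) X n) := by
  have := Fintype.ofFinite ι
  rw [(Ext.biproductAddEquiv (biproduct.isBilimit f) X n).toEquiv.subsingleton_congr]
  refine ⟨fun h i => ?_, fun h => inferInstance⟩
  classical
  exact (Function.surjective_eval (β := fun i => Ext (f i) X n) i).subsingleton

lemma subsingleton_ext_biproduct_right {ι : Type*} [Finite ι] {f : ι → QuiverRep k Q}
    {X : QuiverRep k Q} {n : ℕ} (h : ∀ i, Subsingleton (Ext X (f i) n)) :
    Subsingleton (Ext X (⨁ f) n) := by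
  have := Fintype.ofFinite ι
  rw [(Ext.addEquivBiproduct X (biproduct.isBilimit f) n).toEquiv.subsingleton_congr]
  infer_instance

lemma rightPerp_biproduct_left {ι : Type*} [Finite ι] {f : ι → QuiverRep k Q}
    {X : QuiverRep k Q} : rightPerp (⨁ f) X ↔ ∀ i, rightPerp (f i) X := by
  simp only [rightPerp, forall_and, ← subsingleton_ext_biproduct_left]
  refine and_congr_left fun _ => ⟨fun h i => ⟨fun a b => ?_⟩,
    fun h => ⟨fun _ _ => biproduct.hom_ext' _ _ fun i => Subsingleton.elim _ _⟩⟩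
  rw [← cancel_epi (biproduct.π f i)]
  exact Subsingleton.elim _ _

lemma rightPerp_biproduct_right {ι : Type*} [Finite ι] {f : ι → QuiverRep k Q}
    {X : QuiverRep k Q} (h : ∀ i, rightPerp X (f i)) : rightPerp X (⨁ f) :=
  ⟨⟨fun _ _ => biproduct.hom_ext _ _ fun i => (h i).1.elim _ _⟩,
    subsingleton_ext_biproduct_right fun i => (h i).2⟩

lemma subsingleton_hom_of_mono {V X Y : QuiverRep k Q} (f : X ⟶ Y) [Mono f]
    (h : Subsingleton (V ⟶ Y)) : Subsingleton (V ⟶ X) :=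
  ⟨fun a b => by rw [← cancel_mono f]; exact Subsingleton.elim _ _⟩

section ShortExact

variable {V : QuiverRep k Q} {S : ShortComplex (QuiverRep k Q)} (hS : S.ShortExact)
include hS

lemma subsingleton_ext_X₂ {n : ℕ} (h₁ : Subsingleton (Ext V S.X₁ n))
    (h₃ : Subsingleton (Ext V S.X₃ n)) : Subsingleton (Ext V S.X₂ n) := by
  refine subsingleton_of_forall_eq 0 fun e => ?_
  obtain ⟨e', rfl⟩ := Ext.covariant_sequence_exact₂ V hS e (Subsingleton.elim _ _)
  rw [Subsingleton.elim e' 0, Ext.zero_comp]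

lemma subsingleton_ext_X₁ (h₂ : Subsingleton (Ext V S.X₂ 1))
    (h₃ : Subsingleton (V ⟶ S.X₃)) : Subsingleton (Ext V S.X₁ 1) := by
  refine subsingleton_of_forall_eq 0 fun e => ?_
  obtain ⟨x, rfl⟩ := Ext.covariant_sequence_exact₁ V hS e (Subsingleton.elim _ _) (zero_add 1)
  obtain ⟨q, rfl⟩ := (Ext.mk₀_bijective _ _).2 x
  rw [Subsingleton.elim q 0, Ext.mk₀_zero, Ext.zero_comp]

lemma exists_lift_of_subsingleton_ext (h₁ : Subsingleton (Ext V S.X₁ 1)) (f : V ⟶ S.X₃) :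
    ∃ g : V ⟶ S.X₂, g ≫ S.g = f := by
  obtain ⟨x, hx⟩ := Ext.covariant_sequence_exact₃ V hS (Ext.mk₀ f) (zero_add 1)
    (Subsingleton.elim _ _)
  obtain ⟨g, rfl⟩ := (Ext.mk₀_bijective _ _).2 x
  rw [Ext.mk₀_comp_mk₀] at hx
  exact ⟨g, (Ext.mk₀_bijective _ _).1 hx⟩

lemma rightPerp_X₁ (h₂ : rightPerp V S.X₂) (h₃ : rightPerp V S.X₃) : rightPerp V S.X₁ :=
  have := hS.mono_f
  ⟨subsingleton_hom_of_mono S.f h₂.1, subsingleton_ext_X₁ hS h₂.2 h₃.1⟩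

lemma rightPerp_X₂ (h₁ : rightPerp V S.X₁) (h₃ : rightPerp V S.X₃) : rightPerp V S.X₂ := by
  refine ⟨⟨fun a b => ?_⟩, subsingleton_ext_X₂ hS h₁.2 h₃.2⟩
  have := hS.mono_f
  have h (a : V ⟶ S.X₂) : a = 0 := by
    rw [← hS.exact.lift_f a (h₃.1.elim _ _), h₁.1.elim (hS.exact.lift _ _) 0, zero_comp]
  rw [h a, h b]

lemma rightPerp_X₃ (h₂ : rightPerp V S.X₂) (h₁ : Subsingleton (Ext V S.X₁ 1)) :
    rightPerp V S.X₃ := by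
  have := hS.epi_g
  refine ⟨⟨fun a b => ?_⟩, subsingleton_ext_one_of_epi S.g h₂.2⟩
  obtain ⟨a, rfl⟩ := exists_lift_of_subsingleton_ext hS h₁ a
  obtain ⟨b, rfl⟩ := exists_lift_of_subsingleton_ext hS h₁ b
  rw [h₂.1.elim a b]

end ShortExact

/-- The image of `f` and its cokernel fit into a short exact sequence. -/
lemma image_shortExact {X Y : QuiverRep k Q} (f : X ⟶ Y) :
    (ShortComplex.mk (Abelian.image.ι f) (cokernel.π f)
      (kernel.condition _)).ShortExact where
  exact := ShortComplex.exact_of_f_is_kernel _ (kernelIsKernel (cokernel.π f))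

lemma kernel_shortExact {X Y : QuiverRep k Q} (f : X ⟶ Y) [Epi f] :
    (ShortComplex.mk (kernel.ι f) f (kernel.condition f)).ShortExact where
  exact := ShortComplex.exact_kernel f

/-- Right exactness gives `Ext¹(V, image f) = 0`, so maps from `V` to the cokernel lift to `Y`. -/
lemma rightPerp_cokernel {V X Y : QuiverRep k Q} (f : X ⟶ Y) (hX : rightPerp V X)
    (hY : rightPerp V Y) : rightPerp V (cokernel f) :=
  rightPerp_X₃ (image_shortExact f) hY (subsingleton_ext_one_of_epi (Abelian.factorThruImage f) hX.2)

/-- The projective objects of `V^⊥` are those with vanishing `Ext¹` to all objects of `V^⊥`. -/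
lemma isRelProjectiveWrt_iff {M V : QuiverRep k Q} :
    IsRelProjectiveWrt M V ↔
      rightPerp V M ∧ ∀ X, rightPerp V X → Subsingleton (Ext M X 1) := by
  refine ⟨fun ⟨hM, hp⟩ => ⟨hM, fun X hX => ?_⟩, fun ⟨hM, h⟩ => ⟨hM, ⟨fun {Y Z} f e _ => ?_⟩⟩⟩
  · refine subsingleton_of_forall_eq 0 fun e => ?_
    obtain ⟨ψ, rfl⟩ := exists_eq_cocycleClass FGModuleCat.projective e
    have hS := extShortComplex_shortExact ψ
    have hE : rightPerp V (extObj M X ψ) := rightPerp_X₂ hS hX hM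
    let g : (⟨_, hE⟩ : (rightPerp V).FullSubcategory) ⟶ ⟨M, hM⟩ := ⟨extSnd ψ⟩
    have : Epi g := by
      have : Epi (extSnd ψ) := hS.epi_g
      exact (rightPerp V).ι.epi_of_epi_map this
    obtain ⟨s, hs⟩ := Projective.factors (𝟙 _) g
    have hs' : s.hom ≫ extSnd ψ = 𝟙 M := congrArg (fun t => t.hom) hs
    -- A class dies when pulled back along its own projection, so a section forces it to vanish.
    have h1 : (Ext.mk₀ (extSnd ψ)).comp (cocycleClass ψ) (zero_add 1) = 0 := hS.comp_extClass
    rw [← Ext.mk₀_id_comp (cocycleClass ψ), ← hs', ← Ext.mk₀_comp_mk₀_assoc, h1, Ext.comp_zero]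
  -- Epimorphisms of `V^⊥` are epimorphisms of representations, because cokernels stay in `V^⊥`.
  · have he : Epi e.hom := by
      refine Preadditive.epi_of_cokernel_zero ?_
      have hc := rightPerp_cokernel e.hom Y.property Z.property
      let π : Z ⟶ (⟨_, hc⟩ : (rightPerp V).FullSubcategory) := ⟨cokernel.π e.hom⟩
      have : π = 0 := by
        rw [← cancel_epi e]
        ext1
        exact (cokernel.condition e.hom).trans (comp_zero).symm
      exact congrArg (fun t => t.hom) this
    have hK := rightPerp_X₁ (kernel_shortExact e.hom) Y.property Z.property
    obtain ⟨g, hg⟩ := exists_lift_of_subsingleton_ext (kernel_shortExact e.hom) (h _ hK) f.hom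
    exact ⟨⟨g⟩, by ext1; exact hg⟩

lemma rightPerp_of_iso {V V' W W' : QuiverRep k Q} (i : V ≅ V') (j : W ≅ W')
    (h : rightPerp V W) : rightPerp V' W' := by
  refine ⟨⟨fun a b => ?_⟩, subsingleton_of_forall_eq 0 fun e => ?_⟩
  · rw [← cancel_epi i.hom, ← cancel_mono j.inv]
    exact h.1.elim _ _
  · have h0 := h.2.elim
      ((Ext.mk₀ i.hom).comp (e.comp (Ext.mk₀ j.inv) (add_zero 1)) (zero_add 1)) 0
    have h1 := congrArg
      (fun x => (Ext.mk₀ i.inv).comp (x.comp (Ext.mk₀ j.hom) (add_zero 1)) (zero_add 1)) h0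
    simpa using h1

/-- Let `Ext¹(B, Y) = 0` for a rigid `B`. Then the cokernel of a morphism to `Y` from a sum of
copies of `B` which generates `Hom(B, Y)` is right perpendicular to `B`. -/
lemma rightPerp_cokernel_of_generating {B Y : QuiverRep k Q} {n : ℕ}
    (hB : Subsingleton (Ext B B 1)) (hY : Subsingleton (Ext B Y 1))
    {p : (⨁ fun _ : Fin n => B) ⟶ Y} (hp : ∀ f : B ⟶ Y, ∃ q, f = q ≫ p) :
    rightPerp B (cokernel p) := by
  refine ⟨subsingleton_of_forall_eq 0 fun f => ?_, subsingleton_ext_one_of_epi (cokernel.π p) hY⟩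
  obtain ⟨g, hg⟩ := exists_lift_of_subsingleton_ext (image_shortExact p)
    (subsingleton_ext_one_of_epi (Abelian.factorThruImage p)
      (subsingleton_ext_biproduct_right fun _ => hB)) f
  obtain ⟨q, rfl⟩ := hp g
  rw [← hg, Category.assoc]
  exact (congrArg _ (cokernel.condition p)).trans comp_zero

/-! ### Universal extensions and reordering -/

section Finite

variable [Finite Q]

/-- `Hom(B, X)` is generated by finitely many morphisms. -/
lemma exists_hom_generating (B X : QuiverRep k Q) :
    ∃ (n : ℕ) (p : (⨁ fun _ : Fin n => B) ⟶ X), ∀ f : B ⟶ X, ∃ q, f = q ≫ p := by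
  have := finite_hom B X
  obtain ⟨n, s, hs⟩ := Module.Finite.exists_fin (R := k) (M := B ⟶ X)
  refine ⟨n, biproduct.desc s, fun f => ?_⟩
  obtain ⟨c, rfl⟩ := (Submodule.mem_span_range_iff_exists_fun k).1
    (hs ▸ Submodule.mem_top : f ∈ Submodule.span k (Set.range s))
  exact ⟨biproduct.lift fun i => c i • 𝟙 B, by simp [biproduct.lift_desc]⟩

variable [∀ a b : Q, Finite (a ⟶ b)]

/-- If `B` is rigid, then `X` has an extension `Y` by copies of `B` with `Ext¹(B, Y) = 0`. -/
lemma exists_universal_extension {B : QuiverRep k Q} (hB : Subsingleton (Ext B B 1))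
    (X : QuiverRep k Q) :
    ∃ (n : ℕ) (Y : QuiverRep k Q) (f : X ⟶ Y) (g : Y ⟶ ⨁ fun _ : Fin n => B) (w : f ≫ g = 0),
      (ShortComplex.mk f g w).ShortExact ∧ Subsingleton (Ext B Y 1) := by
  obtain ⟨n, ψ, hψ⟩ := exists_cocycle_generating B X
  have hS := extShortComplex_shortExact ψ
  refine ⟨n, extObj _ X ψ, extInl ψ, extSnd ψ, (extShortComplex ψ).zero, hS,
    subsingleton_of_forall_eq 0 fun e => ?_⟩
  have := subsingleton_ext_biproduct_right (X := B) (f := fun _ : Fin n => B) fun _ => hB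
  -- Every class comes from `Ext¹(B, X)`, hence is a pullback of the universal class, which dies in
  -- `Y`.
  obtain ⟨e', rfl⟩ := Ext.covariant_sequence_exact₂ B hS e (this.elim _ _)
  obtain ⟨q, rfl⟩ := hψ e'
  rw [Ext.comp_assoc_of_third_deg_zero]
  have h0 : (cocycleClass ψ).comp (Ext.mk₀ (extInl ψ)) (add_zero 1) = 0 := hS.extClass_comp
  rw [h0, Ext.comp_zero]

/-- Vanishing of `Ext¹(A, -)` on the objects of a perpendicular category that are right
perpendicular to `B` extends to the whole perpendicular category, provided that `B` is rigid
and right perpendicular to `A`. -/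
lemma subsingleton_ext_of_forall_rightPerp {A B : QuiverRep k Q} {P : Set (QuiverRep k Q)}
    (hB : Subsingleton (Ext B B 1)) (hAB : rightPerp A B) (hPB : ∀ V ∈ P, rightPerp V B)
    (h : ∀ X, rightPerp B X → (∀ V ∈ P, rightPerp V X) → Subsingleton (Ext A X 1))
    {X : QuiverRep k Q} (hX : ∀ V ∈ P, rightPerp V X) : Subsingleton (Ext A X 1) := by
  obtain ⟨n, Y, f, g, w, hS, hY⟩ := exists_universal_extension hB X
  obtain ⟨m, p, hp⟩ := exists_hom_generating B Y
  have hA (l : ℕ) : rightPerp A (⨁ fun _ : Fin l => B) := rightPerp_biproduct_right fun _ => hAB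
  have hP (l : ℕ) (V) (hV : V ∈ P) : rightPerp V (⨁ fun _ : Fin l => B) :=
    rightPerp_biproduct_right fun _ => hPB V hV
  have hPY (V) (hV : V ∈ P) : rightPerp V Y := rightPerp_X₂ hS (hX V hV) (hP n V hV)
  have hcoker : Subsingleton (Ext A (cokernel p) 1) :=
    h _ (rightPerp_cokernel_of_generating hB hY hp) fun V hV =>
      rightPerp_cokernel p (hP m V hV) (hPY V hV)
  have himage : Subsingleton (Ext A (Abelian.image p) 1) :=
    subsingleton_ext_one_of_epi (Abelian.factorThruImage p) (hA m).2
  exact subsingleton_ext_X₁ hS (subsingleton_ext_X₂ (image_shortExact p) himage hcoker) (hA n).1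

/-- Let `p` and `p'` be two positions of the terms of a family of rigid representations, for
both of which it is an exceptional sequence. If `Ext¹(E i, -)` vanishes on the objects
perpendicular to the terms after `i` for `p`, then the same holds for `p'`. -/
lemma subsingleton_ext_of_reorder {ι : Type*} {E : ι → QuiverRep k Q} {p p' : ι → ℕ} {n : ℕ}
    (hp : Function.Injective p) (hp' : Function.Injective p') (hn : ∀ j, p j < n)
    (hE : ∀ j, Subsingleton (Ext (E j) (E j) 1))
    (h : ∀ i j, p j < p i → rightPerp (E i) (E j))
    (h' : ∀ i j, p' j < p' i → rightPerp (E i) (E j)) {i : ι}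
    (hi : ∀ X, (∀ j, p i < p j → rightPerp (E j) X) → Subsingleton (Ext (E i) X 1))
    {X : QuiverRep k Q} (hX : ∀ j, p' i < p' j → rightPerp (E j) X) :
    Subsingleton (Ext (E i) X 1) := by
  -- At stage `m`, the terms at `p`-positions below `m` that do not come after `i` for `p'` have
  -- been dropped.
  have key (m : ℕ) : ∀ X, (∀ j, p i < p j → (p' i < p' j ∨ m ≤ p j) → rightPerp (E j) X) →
      Subsingleton (Ext (E i) X 1) := by
    induction m with
    | zero => exact fun X hX => hi X fun j hj => hX j hj (.inr (Nat.zero_le _))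
    | succ m ih =>
      intro X hX
      by_cases hb : ∃ b, p b = m ∧ p i < p b ∧ ¬ p' i < p' b
      · obtain ⟨b, rfl, hib, hib'⟩ := hb
        have hbi : p' b < p' i := lt_of_le_of_ne (not_lt.1 hib') fun e => by
          rw [hp' e] at hib
          exact lt_irrefl _ hib
        refine subsingleton_ext_of_forall_rightPerp (B := E b)
          (P := {V | ∃ j, p i < p j ∧ (p' i < p' j ∨ p b + 1 ≤ p j) ∧ V = E j}) (hE b)
          (h' _ _ hbi) ?_ ?_ ?_
        · rintro _ ⟨j, _, hj | hj, rfl⟩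
          · exact h' _ _ (hbi.trans hj)
          · exact h _ _ hj
        · refine fun Y hbY hY => ih Y fun j hij hj => ?_
          by_cases hjb : j = b
          · exact hjb ▸ hbY
          · refine hY _ ⟨j, hij, hj.imp_right fun hj => ?_, rfl⟩
            exact lt_of_le_of_ne hj fun e => hjb (hp e.symm)
        · rintro _ ⟨j, hij, hj, rfl⟩
          exact hX j hij hj
      -- No term is dropped at position `m`, so both stages impose the same conditions.
      · refine ih X fun j hij hj => hX j hij ?_
        by_contra hcon
        push Not at hcon hb
        exact hb j (by omega) hij |>.not_ge hcon.1 |>.elim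
  exact key n X fun j _ hj => hX j (hj.resolve_right (hn j).not_ge)

end Finite

/-! ### Independence of the ordering -/

lemma isRelProjectiveIn_iff {m : ℕ} {E : Fin m → QuiverRep k Q} (hE : IsExceptionalSeq E)
    (i : Fin m) : IsRelProjectiveIn E i ↔
      ∀ X, (∀ j, i < j → rightPerp (E j) X) → Subsingleton (Ext (E i) X 1) := by
  rw [IsRelProjectiveIn, isRelProjectiveWrt_iff]
  simp only [rightPerp_biproduct_left, Subtype.forall]
  exact and_iff_right fun j hj => ⟨hE.hom_eq_zero j i hj, hE.ext_eq_zero j i hj⟩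

lemma subsingleton_ext_of_iso {V V' X : QuiverRep k Q} {n : ℕ} (i : V ≅ V')
    (h : Subsingleton (Ext V X n)) : Subsingleton (Ext V' X n) := by
  refine subsingleton_of_forall_eq 0 fun e => ?_
  rw [← Ext.mk₀_id_comp e, ← i.inv_hom_id, ← Ext.mk₀_comp_mk₀_assoc,
    h.elim ((Ext.mk₀ i.hom).comp e (zero_add n)) 0, Ext.comp_zero]

lemma IsExceptionalSeq.injective {m : ℕ} {E : Fin m → QuiverRep k Q} (hE : IsExceptionalSeq E) :
    Function.Injective E := by
  have h (i j) (hij : j < i) : E i ≠ E j := fun e => by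
    have := hE.hom_eq_zero i j hij
    rw [← e] at this
    exact not_subsingleton_iff_nontrivial.2 (hE.exceptional i).end_nontrivial this
  intro i j e
  rcases lt_trichotomy i j with hij | hij | hij
  · exact (h _ _ hij e.symm).elim
  · exact hij
  · exact (h _ _ hij e).elim

/-- Relative projectivity is independent of the ordering of an exceptional sequence. -/
theorem isRelProjectiveIn_iff_of_perm [Finite Q] [∀ a b : Q, Finite (a ⟶ b)] {m : ℕ}
    {E E' : Fin m → QuiverRep k Q} (hE : IsExceptionalSeq E) (hE' : IsExceptionalSeq E')
    (σ : Equiv.Perm (Fin m)) (f : ∀ i, E' i ≅ E (σ i)) (i : Fin m) :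
    IsRelProjectiveIn E' i ↔ IsRelProjectiveIn E (σ i) := by
  have hinj : Function.Injective fun j : Fin m => (j : ℕ) := Fin.val_injective
  -- The term `E j` occupies position `σ.symm j` in the second sequence.
  have hinj' : Function.Injective fun j : Fin m => (σ.symm j : ℕ) := hinj.comp σ.symm.injective
  have hrigid (j) : Subsingleton (Ext (E j) (E j) 1) := (hE.exceptional j).ext_self 1 le_rfl
  have h (a b : Fin m) (hab : (b : ℕ) < a) : rightPerp (E a) (E b) :=
    ⟨hE.hom_eq_zero a b hab, hE.ext_eq_zero a b hab⟩
  have f' (j) : E' (σ.symm j) ≅ E j := f (σ.symm j) ≪≫ eqToIso (by rw [σ.apply_symm_apply])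
  have h' (a b : Fin m) (hab : (σ.symm b : ℕ) < σ.symm a) : rightPerp (E a) (E b) :=
    rightPerp_of_iso (f' a) (f' b) ⟨hE'.hom_eq_zero _ _ hab, hE'.ext_eq_zero _ _ hab⟩
  rw [isRelProjectiveIn_iff hE, isRelProjectiveIn_iff hE']
  constructor
  · intro hi X hX
    refine subsingleton_ext_of_reorder (n := m) hinj' hinj (fun j => (σ.symm j).2) hrigid h' h
      (fun Y hY => subsingleton_ext_of_iso (f i) (hi Y fun j hj => ?_)) hX
    exact rightPerp_of_iso (f j).symm (Iso.refl _) (hY (σ j) (by simpa using hj))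
  · intro hi X hX
    refine subsingleton_ext_of_iso (f i).symm (subsingleton_ext_of_reorder (n := m) hinj hinj'
      (fun j => j.2) hrigid h h' hi fun j hj => ?_)
    exact rightPerp_of_iso (f' j) (Iso.refl _) (hX (σ.symm j) (by simpa using hj))

end QuiverRep

theorem mainTheorem3 {k : Type u} [Field k] {Q : Type v} [Quiver.{w} Q]
    [Finite Q] [∀ a b : Q, Finite (a ⟶ b)] :
    (∀ (E E' : Fin (Nat.card Q) → QuiverRep k Q),
      QuiverRep.IsCompleteExceptionalSeq E → QuiverRep.IsCompleteExceptionalSeq E' →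
      ∀ σ : Equiv.Perm (Fin (Nat.card Q)), (∀ i, Nonempty (E' i ≅ E (σ i))) →
      ∀ i, QuiverRep.IsRelProjectiveIn E' i ↔ QuiverRep.IsRelProjectiveIn E (σ i)) ∧
    (∀ S : Set (QuiverRep k Q), QuiverRep.IsCompleteExceptionalSet S →
      ∃! R : Set (QuiverRep k Q), R ⊆ S ∧
        ∀ E : Fin (Nat.card Q) → QuiverRep k Q,
          QuiverRep.IsCompleteExceptionalSeq E → Set.range E = S →
          ∀ i, QuiverRep.IsRelProjectiveIn E i ↔ E i ∈ R) := by
  have h1 (E E' : Fin (Nat.card Q) → QuiverRep k Q) (hE : QuiverRep.IsCompleteExceptionalSeq E)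
      (hE' : QuiverRep.IsCompleteExceptionalSeq E') (σ : Equiv.Perm (Fin (Nat.card Q)))
      (f : ∀ i, Nonempty (E' i ≅ E (σ i))) (i) :
      QuiverRep.IsRelProjectiveIn E' i ↔ QuiverRep.IsRelProjectiveIn E (σ i) :=
    QuiverRep.isRelProjectiveIn_iff_of_perm hE.1 hE'.1 σ (fun i => (f i).some) i
  refine ⟨h1, fun S ⟨E, hE, hES⟩ => ⟨{X | ∃ i, E i = X ∧ QuiverRep.IsRelProjectiveIn E i},
    ⟨?_, fun E' hE' hES' i => ?_⟩, ?_⟩⟩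
  · rintro _ ⟨i, rfl, _⟩
    exact hES ▸ Set.mem_range_self i
  · have hex (i) : ∃ j, E j = E' i := by
      rw [← Set.mem_range, hES, ← hES']
      exact Set.mem_range_self i
    -- Two orderings of the same set differ by a permutation `τ`, since terms of an exceptional
    -- sequence are distinct.
    choose τ hτ using hex
    have hinj : Function.Injective τ := fun a b hab => hE'.1.injective (by rw [← hτ, hab, hτ])
    rw [h1 E E' hE hE' (Equiv.ofBijective τ (Finite.injective_iff_bijective.1 hinj))
      (fun i => ⟨eqToIso (hτ i).symm⟩) i]
    refine ⟨fun h => ⟨τ i, hτ i, h⟩, fun ⟨j, hj, h⟩ => ?_⟩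
    rw [hE.1.injective (hj.trans (hτ i).symm)] at h
    exact h
  · rintro R ⟨hRS, hR⟩
    ext X
    refine ⟨fun hX => ?_, ?_⟩
    · obtain ⟨i, rfl⟩ := hES.symm ▸ hRS hX
      exact ⟨i, rfl, (hR E hE hES i).2 hX⟩
    · rintro ⟨i, rfl, hi⟩
      exact (hR E hE hES i).1 hi
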